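/- Let $G$ be a finite, connected, directed multigraph (loops and multiple edges allowed) embedded in the oriented plane, with vertex set $V$, edge set $E$ and set $\mathcal F$ of bounded faces. Let $a\colon E\to\mathbb C$, and label each edge $e$ by $\ell(e)=(x+a_ey)^2\in\mathbb C[x,y]$. For $F\in\mathcal F$ and $e\in E$ put $\varepsilon_{F,e}=1$ if $e$ points clockwise around $F$, $\varepsilon_{F,e}=-1$ if it points counterclockwise around $F$, and $\varepsilon_{F,e}=0$ if $e$ is not on the boundary of $F$ or has $F$ on both of its sides. The extended cycle basis matrix $M^{\mathsf{ext}}_G$ is the $3|\mathcal F|\times|E|$ matrix that has, for each $F$, three rows with entries $\varepsilon_{F,e}$, $\varepsilon_{F,e}a_e$, $\varepsilon_{F,e}a_e^2$ in column $e$. For $v_0\in V$ let $\mathrm{Spl}_2(G,\ell;v_0)$ be the complex vector space of all maps $p$ from $V$ to the homogeneous polynomials of degree $2$ in $\mathbb C[x,y]$ (including $0$) such that $p(v_0)=0$ and $\ell(e)$ divides $p(u)-p(v)$ for every edge $e$ from $u$ to $v$. Let $S\subseteq\mathcal F$ be a set of $f'$ bounded faces, and let $G'$ be the subgraph that consists of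 these faces, with the vertices and the $e'$ edges on their boundaries. Let $M^{\mathsf{ext}}_{G'}$ be the $3f'\times e'$ submatrix of $M^{\mathsf{ext}}_G$ with the rows of the faces in $S$ and the columns of the edges of $G'$. Let $G\backslash G'$ be the contraction of $G$ along $G'$: the endpoints of every edge of $G'$ are identified, the edges of $G'$ are removed, and all other edges keep their directions and labels. Assume that $e'\le 3f'$ and that the edge labels of $G'$ are generic and not in special position, that is, for $d=\min\{e',3f'\}$ there is a $d\times d$ submatrix of $M^{\mathsf{ext}}_{G'}$ whose determinant is not identically zero as a polynomial in indeterminates $a_e$ and does not vanish at the given values $a_e$. Then the following hold. 1. After ordering the rows (faces in $S$ first) and the columns (edges of $G'$ first), $$M^{\mathsf{ext}}_G=\begin{pmatrix}M^{\mathsf{ext}}_{G'}&0\\ *&D\end{pmatrix},$$ where $D$ is the submatrix of $M^{\mathsf{ext}}_G$ with the rows of the bounded faces not in $S$ and the columns of the edges not in $G'$; and $\operatorname{rank}M^{\mathsf{ext}}_G=\operatorname{rank}M^{\mathsf{ext}}_{G'}+\operatorname{rank}D$. 2. For every plane embedding of the contracted graph $G\backslash G'$, its extended cycle basis matrix satisfies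 $$\operatorname{rank}M^{\mathsf{ext}}_G=\operatorname{rank}M^{\mathsf{ext}}_{G'}+\operatorname{rank}M^{\mathsf{ext}}_{G\backslash G'}.$$ 3. For every $v_0\in V$, denoting its image in $G\backslash G'$ also by $v_0$, $$\dim\mathrm{Spl}_2(G,\ell;v_0)=\dim\mathrm{Spl}_2(G\backslash G',\ell;v_0).$$ -/

import Mathlib

/-- A directed multigraph with vertex type `V` and edge type `E`; loops and multiple edges are
allowed. -/
structure DirectedMultigraph (V E : Type*) where
  /-- The initial vertex of an edge. -/
  src : E → V
  /-- The terminal vertex of an edge. -/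
  tgt : E → V

namespace DirectedMultigraph

variable {V E : Type*}

/-- Connectedness of the underlying undirected graph (nonempty, any two vertices are joined by a
walk that may use edges in either direction). -/
def Connected (G : DirectedMultigraph V E) : Prop :=
  Nonempty V ∧ ∀ u v : V, Relation.EqvGen (fun x y => ∃ e, G.src e = x ∧ G.tgt e = y) u v

/-- The darts (oriented edges) are the pairs `(e, b)`: `(e, true)` is `e` traversed along its
direction, `(e, false)` is `e` traversed against it. This is the vertex at which a dart starts. -/
def origin (G : DirectedMultigraph V E) (d : E × Bool) : V :=
  if d.2 then G.src d.1 else G.tgt d.1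

/-- Reversal of darts. -/
def rev : Equiv.Perm (E × Bool) :=
  Equiv.prodCongr (Equiv.refl E) Equiv.boolNot

/-- An embedding into the oriented plane of a connected multigraph `G`, with `F` as its set of
bounded faces, given combinatorially by its rotation system.

* `rot` sends a dart to the next dart in counterclockwise order around its initial vertex.
* Consequently `rev` followed by `rot` sends a dart to the next dart on the boundary walk of the
  face that lies to its right; the orbits of this permutation are the (boundary walks of the)
  faces.
* `face d` is the face to the right of the dart `d`, with `none` standing for the unbounded face.
  Thus the boundary walk of a bounded face, as given by the darts with that face to their right,
  is traversed clockwise.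
* `euler` is Euler's formula `|V| - |E| + (|F| + 1) = 2`, that is, the surface obtained by glueing
  a disc along each boundary walk is the sphere.

If `G` is a single vertex without edges, then there are no darts, and the unbounded face is the
only face. -/
structure PlaneEmbedding (G : DirectedMultigraph V E) (F : Type*) where
  connected : G.Connected
  rot : Equiv.Perm (E × Bool)
  rot_sameCycle_iff : ∀ d d', rot.SameCycle d d' ↔ G.origin d = G.origin d'
  face : E × Bool → Option F
  face_sameCycle_iff : ∀ d d', (rot * rev).SameCycle d d' ↔ face d = face d'
  exists_face_eq_some : ∀ f : F, ∃ d, face d = some f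
  exists_face_eq_none : Nonempty E → ∃ d, face d = none
  euler : Nat.card V + Nat.card F = Nat.card E + 1

namespace PlaneEmbedding

variable {F R : Type*} [DecidableEq F] [CommRing R] {G : DirectedMultigraph V E}

/-- The cycle basis matrix, with rows indexed by the bounded faces: the entry at `(f, e)` is `1`
if `e` points clockwise around `f`, `-1` if it points counterclockwise around `f`, and `0` if `e`
is not on the boundary of `f`. (An edge that has `f` on both of its sides is traversed once in each
direction by the boundary walk of `f`; its entry is `1 - 1 = 0`.) -/
def cycleMatrix (P : G.PlaneEmbedding F) : Matrix F E ℤ := fun f e =>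
  (if P.face (e, true) = some f then 1 else 0) - (if P.face (e, false) = some f then 1 else 0)

/-- The extended cycle basis matrix for the edge labels `(x + a e * y) ^ 2`: the entry `ε` of the
cycle basis matrix at `(f, e)` is replaced by the three entries `ε`, `ε * a e`, `ε * (a e) ^ 2`
in the three rows that belong to `f`. -/
def extMatrix (P : G.PlaneEmbedding F) (a : E → R) : Matrix (F × Fin 3) E R := fun i e =>
  (P.cycleMatrix i.1 e : R) * a e ^ (i.2 : ℕ)

/-- The edges of the subgraph `G'` formed by a set `S` of bounded faces: all edges that have a
face of `S` on at least one of their sides. -/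
def boundaryEdges [Fintype E] (P : G.PlaneEmbedding F) (S : Finset F) : Finset E :=
  Finset.univ.filter fun e => ∃ f ∈ S, ∃ b : Bool, P.face (e, b) = some f

/-- The extended cycle basis matrix of the subgraph `G'` formed by the faces in `S`: the submatrix
of the extended cycle basis matrix of `G` with the rows of the faces in `S` and the columns of the
edges of `G'`. -/
def innerBlock [Fintype E] (P : G.PlaneEmbedding F) (S : Finset F) (a : E → R) :
    Matrix ({f // f ∈ S} × Fin 3) {e // e ∈ P.boundaryEdges S} R :=
  (P.extMatrix a).submatrix (Prod.map Subtype.val id) Subtype.val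

/-- The complementary diagonal block: the submatrix of the extended cycle basis matrix of `G` with
the rows of the bounded faces outside `S` and the columns of the edges outside `G'`. -/
def outerBlock [Fintype E] (P : G.PlaneEmbedding F) (S : Finset F) (a : E → R) :
    Matrix ({f // f ∉ S} × Fin 3) {e // e ∉ P.boundaryEdges S} R :=
  (P.extMatrix a).submatrix (Prod.map Subtype.val id) Subtype.val

/-- The edge labels `(x + a e * y) ^ 2` of the subgraph `G'` formed by the faces in `S` are generic
(and not in special position): with `d = min e' (3 f')`, some `d × d` submatrix of the extended
cycle basis matrix of `G'` has a determinant which is not identically zero as a polynomial in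
indeterminate labels, and the actual labels `a` are not a root of this polynomial. -/
def GenericLabels [Fintype E] (P : G.PlaneEmbedding F) (S : Finset F) (a : E → R) : Prop :=
  ∃ (r : Fin (min (P.boundaryEdges S).card (3 * S.card)) ↪ {f // f ∈ S} × Fin 3)
    (c : Fin (min (P.boundaryEdges S).card (3 * S.card)) ↪ {e // e ∈ P.boundaryEdges S}),
    ((P.innerBlock S (MvPolynomial.X : E → MvPolynomial E R)).submatrix r c).det ≠ 0 ∧
      MvPolynomial.eval a
        ((P.innerBlock S (MvPolynomial.X : E → MvPolynomial E R)).submatrix r c).det ≠ 0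

end PlaneEmbedding

/-- The vertices of the contraction of `G` along a set `T` of edges: the two endpoints of each edge
in `T` are identified (`Quot` takes the generated equivalence relation), so each connected component
of the subgraph formed by `T` becomes one vertex, and all other vertices stay as they are. -/
abbrev ContractVertex (G : DirectedMultigraph V E) (T : Finset E) : Type _ :=
  Quot fun u v : V => ∃ e ∈ T, G.src e = u ∧ G.tgt e = v

/-- The contraction of `G` along a set `T` of edges. Its edges are the edges of `G` outside `T`,
with their directions; they may become loops or parallel edges. -/
def contract (G : DirectedMultigraph V E) (T : Finset E) :
    DirectedMultigraph (G.ContractVertex T) {e // e ∉ T} where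
  src e := Quot.mk _ (G.src e)
  tgt e := Quot.mk _ (G.tgt e)

/-- `p` is a spline on the edge-labelled graph `(G, ℓ)`. -/
def IsSpline {R : Type*} [CommRing R] (G : DirectedMultigraph V E) (ℓ : E → R) (p : V → R) : Prop :=
  ∀ e, ℓ e ∣ p (G.src e) - p (G.tgt e)

/-- The space `Spl_d(G, ℓ; v₀)` of homogeneous splines of degree `d` on `(G, ℓ)` (each `p v` is zero
or homogeneous of degree `d`) that vanish at `v₀`. It is the complement of the constant splines
among the homogeneous splines of degree `d`. -/
def splineSpace {K : Type*} [CommRing K] (G : DirectedMultigraph V E) (d : ℕ)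
    (ℓ : E → MvPolynomial (Fin 2) K) (v₀ : V) : Submodule K (V → MvPolynomial (Fin 2) K) where
  carrier := {p | (∀ v, (p v).IsHomogeneous d) ∧ G.IsSpline ℓ p ∧ p v₀ = 0}
  zero_mem' := ⟨fun _ => MvPolynomial.isHomogeneous_zero _ _ _, fun e => by simp, rfl⟩
  add_mem' := by
    rintro p q ⟨hp, hp', hp0⟩ ⟨hq, hq', hq0⟩
    refine ⟨fun v => (hp v).add (hq v), fun e => ?_, by simp [hp0, hq0]⟩
    have h := dvd_add (hp' e) (hq' e)
    rwa [show p (G.src e) - p (G.tgt e) + (q (G.src e) - q (G.tgt e))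
      = (p + q) (G.src e) - (p + q) (G.tgt e) by simp only [Pi.add_apply]; ring] at h
  smul_mem' := by
    rintro c p ⟨hp, hp', hp0⟩
    refine ⟨fun v => ?_, fun e => ?_, by simp [hp0]⟩
    · rw [Pi.smul_apply, MvPolynomial.smul_eq_C_mul]
      simpa using (MvPolynomial.isHomogeneous_C (Fin 2) c).mul (hp v)
    · have h := (hp' e).mul_left (MvPolynomial.C c)
      rwa [mul_sub, ← MvPolynomial.smul_eq_C_mul, ← MvPolynomial.smul_eq_C_mul] at h

/-- The homogeneous edge labels `(x + a e * y) ^ 2` in the polynomial ring in `x, y`. -/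
noncomputable def squareLabel {K : Type*} [CommRing K] (a : E → K) (e : E) :
    MvPolynomial (Fin 2) K :=
  (MvPolynomial.X 0 + MvPolynomial.C (a e) * MvPolynomial.X 1) ^ 2

end DirectedMultigraph

theorem Matrix.rank_fromBlocks_zero₁₂_of_mulVec_injective {K l m n o : Type*} [Field K]
    [Fintype n] [Fintype o]
    (A : Matrix m n K) (B : Matrix l n K) (D : Matrix l o K)
    (hA : Function.Injective A.mulVec) :
    (Matrix.fromBlocks A 0 B D).rank = A.rank + D.rank := by
  let j : (o → K) →ₗ[K] (n ⊕ o → K) :=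
    { toFun := fun w => Sum.elim 0 w
      map_add' := fun x y => by ext (i | i) <;> simp
      map_smul' := fun c x => by ext (i | i) <;> simp }
  have hj : Function.Injective j := fun x y h => funext fun i => congrFun h (Sum.inr i)
  have hker : LinearMap.ker (Matrix.fromBlocks A 0 B D).mulVecLin
      = (LinearMap.ker D.mulVecLin).map j := by
    ext v
    simp only [LinearMap.mem_ker, Matrix.mulVecLin_apply, Submodule.mem_map,
      Matrix.fromBlocks_mulVec, Matrix.zero_mulVec, add_zero]
    constructor
    · intro h
      have h1 : A.mulVec (v ∘ Sum.inl) = 0 := funext fun i => congrFun h (Sum.inl i)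
      have h0 : v ∘ Sum.inl = 0 := hA (h1.trans (Matrix.mulVec_zero A).symm)
      refine ⟨v ∘ Sum.inr, ?_, ?_⟩
      · funext i
        simpa [h0] using congrFun h (Sum.inr i)
      · funext i
        rcases i with i | i
        · exact (congrFun h0 i).symm
        · rfl
    · rintro ⟨w, hw, rfl⟩
      have h0 : j w ∘ Sum.inl = 0 := rfl
      have h1 : j w ∘ Sum.inr = w := rfl
      rw [h0, h1, hw]
      funext i
      rcases i with i | i <;> simp
  have h1 := LinearMap.finrank_range_add_finrank_ker (Matrix.fromBlocks A 0 B D).mulVecLin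
  have h2 := LinearMap.finrank_range_add_finrank_ker D.mulVecLin
  have h3 : A.rank = Fintype.card n := by
    rw [Matrix.rank, LinearMap.finrank_range_of_inj (f := A.mulVecLin) hA, Module.finrank_pi]
  rw [hker, LinearEquiv.finrank_eq (Submodule.equivMapOfInjective j hj _).symm,
    Module.finrank_pi, Fintype.card_sum] at h1
  rw [Module.finrank_pi] at h2
  rw [h3]
  simp only [Matrix.rank]
  omega

namespace DirectedMultigraph

variable {V E F K : Type*} {G : DirectedMultigraph V E}

theorem Connected.apply_eq {α : Type*} (hG : G.Connected) {h : V → α}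
    (hh : ∀ e, h (G.src e) = h (G.tgt e)) (u v : V) : h u = h v := by
  induction hG.2 u v with
  | rel x y hxy => obtain ⟨e, rfl, rfl⟩ := hxy; exact hh e
  | refl x => rfl
  | symm x y _ ih => exact ih.symm
  | trans x y z _ _ ih₁ ih₂ => exact ih₁.trans ih₂

/-- The coboundary map, which sends a potential on the vertices to its differences along the
edges. -/
def coboundary (K : Type*) [Field K] (G : DirectedMultigraph V E) : (V → K) →ₗ[K] (E → K) :=
  LinearMap.funLeft K K G.src - LinearMap.funLeft K K G.tgt

@[simp]
theorem coboundary_apply [Field K] (p : V → K) (e : E) :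
    G.coboundary K p e = p (G.src e) - p (G.tgt e) := rfl

theorem Connected.finrank_range_coboundary [Field K] [Finite V] (hG : G.Connected) :
    Module.finrank K (LinearMap.range (G.coboundary K)) + 1 = Nat.card V := by
  have := Fintype.ofFinite V
  have hker : LinearMap.ker (G.coboundary K) = K ∙ (1 : V → K) := by
    ext p
    rw [LinearMap.mem_ker, Submodule.mem_span_singleton]
    constructor
    · intro hp
      obtain ⟨v⟩ := hG.1
      refine ⟨p v, funext fun u => ?_⟩
      simpa using hG.apply_eq (fun e => sub_eq_zero.1 (congrFun hp e)) v u
    · rintro ⟨c, rfl⟩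
      funext e
      simp
  have hone : (1 : V → K) ≠ 0 := by
    obtain ⟨v⟩ := hG.1
    exact fun h => one_ne_zero (congrFun h v)
  have h := LinearMap.finrank_range_add_finrank_ker (G.coboundary K)
  rwa [hker, finrank_span_singleton hone, Module.finrank_pi, ← Nat.card_eq_fintype_card] at h

namespace PlaneEmbedding

theorem origin_rot_mul_rev (P : G.PlaneEmbedding F) (d : E × Bool) :
    G.origin ((P.rot * rev : Equiv.Perm (E × Bool)) d) = G.origin (rev d) :=
  ((P.rot_sameCycle_iff _ _).1 (Equiv.Perm.SameCycle.refl P.rot (rev d)).apply_right).symm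

theorem face_rot_mul_rev (P : G.PlaneEmbedding F) (d : E × Bool) :
    P.face ((P.rot * rev : Equiv.Perm (E × Bool)) d) = P.face d :=
  ((P.face_sameCycle_iff _ _).1 (Equiv.Perm.SameCycle.refl (P.rot * rev) d).apply_right).symm

variable [DecidableEq F]

theorem cycleMatrix_mul_coboundary [Field K] [Fintype E] (P : G.PlaneEmbedding F) (p : V → K)
    (f : F) : ∑ e, (P.cycleMatrix f e : K) * G.coboundary K p e = 0 := by
  have h1 : ∑ d : E × Bool, (if P.face d = some f then p (G.origin d) else 0)
      = ∑ d : E × Bool, (if P.face d = some f then p (G.origin (rev d)) else 0) := by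
    rw [← Equiv.sum_comp (P.rot * rev : Equiv.Perm (E × Bool))]
    simp only [origin_rot_mul_rev, face_rot_mul_rev]
  rw [← sub_eq_zero, ← Finset.sum_sub_distrib, Fintype.sum_prod_type] at h1
  rw [← h1]
  refine Finset.sum_congr rfl fun e _ => ?_
  simp only [Fintype.sum_bool, cycleMatrix, coboundary_apply, origin, rev,
    Equiv.prodCongr_apply, Prod.map, Equiv.refl_apply, Equiv.boolNot_apply, Bool.not_true,
    Bool.not_false, if_true, Bool.false_eq_true, if_false]
  split_ifs <;> push_cast <;> ring

theorem linearIndependent_cycleMatrix [Field K] [Fintype F] (P : G.PlaneEmbedding F) :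
    LinearIndependent K (P.cycleMatrix.map (Int.cast : ℤ → K)).row := by
  classical
  rw [Fintype.linearIndependent_iff]
  intro c hc f
  let μ : Option F → K := fun o => o.elim 0 c
  have hμ (o : Option F) : ∑ f, c f * (if o = some f then 1 else 0) = μ o := by
    cases o <;> simp [μ]
  have hedge (e : E) : μ (P.face (e, true)) = μ (P.face (e, false)) := by
    rw [← sub_eq_zero, ← hμ, ← hμ, ← Finset.sum_sub_distrib]
    refine Eq.trans ?_ (congrFun hc e)
    simp only [Finset.sum_apply, Pi.smul_apply, smul_eq_mul, Matrix.row, Matrix.map_apply,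
      cycleMatrix]
    refine Finset.sum_congr rfl fun f _ => ?_
    push_cast
    ring
  have hrev (d : E × Bool) : μ (P.face (rev d)) = μ (P.face d) := by
    obtain ⟨e, b⟩ := d
    cases b
    · exact hedge e
    · exact (hedge e).symm
  have hrot (d : E × Bool) : μ (P.face (P.rot d)) = μ (P.face d) := by
    have h := P.face_rot_mul_rev (rev.symm d)
    rw [Equiv.Perm.mul_apply, Equiv.apply_symm_apply] at h
    rw [h, ← hrev, Equiv.apply_symm_apply]
  have hcycle {d d' : E × Bool} (h : G.origin d = G.origin d') :
      μ (P.face d) = μ (P.face d') := by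
    obtain ⟨n, rfl⟩ := (P.rot_sameCycle_iff d d').2 h
    have hz (n : ℤ) (d : E × Bool) : μ (P.face ((P.rot ^ n) d)) = μ (P.face d) := by
      induction n generalizing d with
      | zero => rfl
      | succ n ih => rw [zpow_add_one, Equiv.Perm.mul_apply, ih, hrot]
      | pred n ih =>
        rw [zpow_sub_one, Equiv.Perm.mul_apply, ih, ← hrot, ← Equiv.Perm.mul_apply,
          mul_inv_cancel, Equiv.Perm.one_apply]
    exact (hz n d).symm
  let h : V → K := fun v => if hv : ∃ d, G.origin d = v then μ (P.face hv.choose) else 0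
  have hh (d : E × Bool) : h (G.origin d) = μ (P.face d) := by
    have hd : ∃ d', G.origin d' = G.origin d := ⟨d, rfl⟩
    simp only [h, dif_pos hd]
    exact hcycle hd.choose_spec
  obtain ⟨d, hd⟩ := P.exists_face_eq_some f
  obtain ⟨d', hd'⟩ := P.exists_face_eq_none ⟨d.1⟩
  have key := P.connected.apply_eq (h := h)
    (fun e => (hh (e, true)).trans ((hedge e).trans (hh (e, false)).symm))
    (G.origin d) (G.origin d')
  rw [hh, hh, hd, hd'] at key
  exact key

/-- The cycle space of a plane graph is spanned by the boundaries of the bounded faces. -/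
theorem ker_cycleMatrix [Field K] [Finite V] [Fintype E] [Fintype F] (P : G.PlaneEmbedding F) :
    LinearMap.ker (P.cycleMatrix.map (Int.cast : ℤ → K)).mulVecLin
      = LinearMap.range (G.coboundary K) := by
  symm
  apply Submodule.eq_of_le_of_finrank_eq
  · rintro _ ⟨p, rfl⟩
    rw [LinearMap.mem_ker]
    exact funext fun f => P.cycleMatrix_mul_coboundary p f
  · have h1 := P.connected.finrank_range_coboundary (K := K)
    have h2 := LinearMap.finrank_range_add_finrank_ker
      (P.cycleMatrix.map (Int.cast : ℤ → K)).mulVecLin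
    have h3 := (P.linearIndependent_cycleMatrix (K := K)).rank_matrix
    have h4 := P.euler
    rw [Matrix.rank] at h3
    rw [h3, Module.finrank_pi] at h2
    rw [Nat.card_eq_fintype_card (α := E), Nat.card_eq_fintype_card (α := F)] at h4
    omega

theorem mem_ker_extMatrix_iff [Field K] [Finite V] [Fintype E] [Fintype F]
    (P : G.PlaneEmbedding F) (a c : E → K) :
    c ∈ LinearMap.ker (P.extMatrix a).mulVecLin ↔
      ∀ i : Fin 3, ∃ q : V → K, ∀ e, c e * a e ^ (i : ℕ) = q (G.src e) - q (G.tgt e) := by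
  have h : ∀ i : Fin 3, (∃ q : V → K, ∀ e, c e * a e ^ (i : ℕ) = q (G.src e) - q (G.tgt e)) ↔
      (fun e => c e * a e ^ (i : ℕ)) ∈ LinearMap.range (G.coboundary K) := fun i =>
    exists_congr fun q => ⟨fun h => funext fun e => (h e).symm, fun h e => (congrFun h e).symm⟩
  simp only [h, ← P.ker_cycleMatrix, LinearMap.mem_ker, funext_iff, Prod.forall,
    Matrix.mulVecLin_apply, Matrix.mulVec, dotProduct, extMatrix, Matrix.map_apply,
    Pi.zero_apply]
  rw [forall_comm]
  refine forall₂_congr fun i f => ?_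
  rw [Finset.sum_congr rfl fun e _ => ?_]
  ring

end PlaneEmbedding

section Splines

open MvPolynomial

variable [Field K]

theorem squareLabel_isHomogeneous (a : E → K) (e : E) : (squareLabel a e).IsHomogeneous 2 := by
  have h : (X 0 + C (a e) * X 1 : MvPolynomial (Fin 2) K).IsHomogeneous 1 := by
    refine (isHomogeneous_X K 0).add ?_
    simpa using (isHomogeneous_C (Fin 2) (a e)).mul (isHomogeneous_X K 1)
  simpa [squareLabel] using h.pow 2

theorem eval_squareLabel (a : E → K) (e : E) (x y : K) :
    eval ![x, y] (squareLabel a e) = (x + a e * y) ^ 2 := by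
  simp [squareLabel]

theorem squareLabel_ne_zero (a : E → K) (e : E) : squareLabel a e ≠ 0 := fun h => by
  have := eval_squareLabel a e 1 0
  simp [h] at this

theorem eq_C_mul_squareLabel {a : E → K} {e : E} {p : MvPolynomial (Fin 2) K}
    (hp : p.IsHomogeneous 2) (hdvd : squareLabel a e ∣ p) :
    p = C (eval ![1, 0] p) * squareLabel a e := by
  obtain ⟨q, rfl⟩ := hdvd
  obtain ⟨c, rfl⟩ : ∃ c, q = C c := by
    by_cases hq : q = 0
    · exact ⟨0, by simp [hq]⟩
    refine ⟨_, totalDegree_eq_zero_iff_eq_C.1 ?_⟩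
    have h := totalDegree_mul_of_isDomain (squareLabel_ne_zero a e) hq
    rw [hp.totalDegree (mul_ne_zero (squareLabel_ne_zero a e) hq),
      (squareLabel_isHomogeneous a e).totalDegree (squareLabel_ne_zero a e)] at h
    omega
  rw [map_mul, eval_squareLabel]
  simp [mul_comm]

/-- The values at `(1, 0)` of the differences along the edges of a family of polynomials. For a
homogeneous spline of degree `2`, these are the quotients of the differences by the labels. -/
noncomputable def edgeCoeff (K : Type*) [Field K] (G : DirectedMultigraph V E) :
    (V → MvPolynomial (Fin 2) K) →ₗ[K] (E → K) :=
  G.coboundary K ∘ₗ LinearMap.compLeft (MvPolynomial.aeval ![(1 : K), 0]).toLinearMap V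

theorem edgeCoeff_apply (p : V → MvPolynomial (Fin 2) K) (e : E) :
    G.edgeCoeff K p e = eval ![1, 0] (p (G.src e) - p (G.tgt e)) := by
  simp [edgeCoeff, aeval_eq_eval]

theorem sub_eq_of_mem_splineSpace {a : E → K} {v₀ : V} {p : V → MvPolynomial (Fin 2) K}
    (hp : p ∈ G.splineSpace 2 (squareLabel a) v₀) (e : E) :
    p (G.src e) - p (G.tgt e) = C (G.edgeCoeff K p e) * squareLabel a e := by
  rw [edgeCoeff_apply]
  exact eq_C_mul_squareLabel ((hp.1 _).sub (hp.1 _)) (hp.2.1 e)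

theorem Connected.edgeCoeff_injOn (hG : G.Connected) (a : E → K) (v₀ : V) :
    Function.Injective ((G.edgeCoeff K).domRestrict (G.splineSpace 2 (squareLabel a) v₀)) := by
  rw [← LinearMap.ker_eq_bot, LinearMap.ker_eq_bot']
  rintro ⟨p, hp⟩ h
  ext1
  funext v
  refine (hG.apply_eq (fun e => ?_) v v₀).trans hp.2.2
  have he : G.edgeCoeff K p e = 0 := congrFun h e
  rw [← sub_eq_zero, sub_eq_of_mem_splineSpace hp, he, C_0, zero_mul]

theorem PlaneEmbedding.map_edgeCoeff_splineSpace [DecidableEq F] [Finite V] [Fintype E] [Fintype F]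
    (P : G.PlaneEmbedding F) (h2 : (2 : K) ≠ 0) (a : E → K) (v₀ : V) :
    (G.splineSpace 2 (squareLabel a) v₀).map (G.edgeCoeff K)
      = LinearMap.ker (P.extMatrix a).mulVecLin := by
  ext c
  rw [P.mem_ker_extMatrix_iff]
  constructor
  · rintro ⟨p, hp, rfl⟩
    have key (x y : K) (e : E) : eval ![x, y] (p (G.src e)) - eval ![x, y] (p (G.tgt e)) =
        G.edgeCoeff K p e * (x + a e * y) ^ 2 := by
      rw [← map_sub, sub_eq_of_mem_splineSpace hp, map_mul, eval_C, eval_squareLabel]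
    intro i
    fin_cases i
    · exact ⟨fun v => eval ![1, 0] (p v), fun e => by rw [key]; simp⟩
    · refine ⟨fun v => (eval ![1, 1] (p v) - eval ![1, 0] (p v) - eval ![0, 1] (p v)) / 2,
        fun e => ?_⟩
      rw [← sub_div, eq_div_iff h2]
      dsimp only
      linear_combination -key 1 1 e + key 1 0 e + key 0 1 e
    · exact ⟨fun v => eval ![0, 1] (p v), fun e => by rw [key]; simp⟩
  · intro h
    choose q hq using h
    let p : V → MvPolynomial (Fin 2) K := fun v =>
      C (q 0 v - q 0 v₀) * X 0 ^ 2 + C (2 * (q 1 v - q 1 v₀)) * (X 0 * X 1)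
        + C (q 2 v - q 2 v₀) * X 1 ^ 2
    have hsub (e : E) : p (G.src e) - p (G.tgt e) = C (c e) * squareLabel a e := by
      have h0 := congrArg (C : K → MvPolynomial (Fin 2) K) (hq 0 e)
      have h1 := congrArg (C : K → MvPolynomial (Fin 2) K) (hq 1 e)
      have h2 := congrArg (C : K → MvPolynomial (Fin 2) K) (hq 2 e)
      simp only [Fin.val_zero, Fin.val_one, Fin.val_two, pow_zero, pow_one, map_mul, map_sub,
        map_pow, map_one] at h0 h1 h2
      simp only [p, squareLabel, map_sub, map_mul, map_ofNat]
      linear_combination -X 0 ^ 2 * h0 - 2 * X 0 * X 1 * h1 - X 1 ^ 2 * h2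
    refine ⟨p, ⟨fun v => ?_, fun e => ⟨C (c e), by rw [hsub, mul_comm]⟩, by simp [p]⟩, ?_⟩
    · have hX (i : Fin 2) := isHomogeneous_X K i
      refine ((IsHomogeneous.C_mul ((hX 0).pow 2) _).add
        (IsHomogeneous.C_mul ((hX 0).mul (hX 1)) _)).add (IsHomogeneous.C_mul ((hX 1).pow 2) _)
    · funext e
      rw [edgeCoeff_apply, hsub, map_mul, eval_C, eval_squareLabel]
      simp

theorem PlaneEmbedding.rank_extMatrix_add_finrank_splineSpace [DecidableEq F] [Finite V]
    [Fintype E] [Fintype F] (P : G.PlaneEmbedding F) (h2 : (2 : K) ≠ 0) (a : E → K) (v₀ : V) :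
    (P.extMatrix a).rank + Module.finrank K (G.splineSpace 2 (squareLabel a) v₀)
      = Fintype.card E := by
  have h := LinearMap.finrank_range_add_finrank_ker (P.extMatrix a).mulVecLin
  rwa [← P.map_edgeCoeff_splineSpace h2 a v₀, ← LinearMap.range_domRestrict,
    LinearMap.finrank_range_of_inj (P.connected.edgeCoeff_injOn a v₀), Module.finrank_pi] at h

theorem finrank_splineSpace_contract (T : Finset E) (a : E → K) (v₀ : V)
    (hT : ∀ p ∈ G.splineSpace 2 (squareLabel a) v₀, ∀ e ∈ T, G.edgeCoeff K p e = 0) :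
    Module.finrank K ((G.contract T).splineSpace 2 (squareLabel fun e => a e.1) (Quot.mk _ v₀))
      = Module.finrank K (G.splineSpace 2 (squareLabel a) v₀) := by
  let π : V → G.ContractVertex T := Quot.mk _
  let φ := LinearMap.funLeft K (MvPolynomial (Fin 2) K) π
  have hφ : Function.Injective φ := LinearMap.funLeft_injective_of_surjective _ _ _ Quot.mk_surjective
  rw [LinearEquiv.finrank_eq (Submodule.equivMapOfInjective φ hφ _)]
  suffices h : ((G.contract T).splineSpace 2 (squareLabel fun e => a e.1) (Quot.mk _ v₀)).map φ
      = G.splineSpace 2 (squareLabel a) v₀ by rw [h]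
  ext p
  constructor
  · rintro ⟨p, ⟨hp, hs, h0⟩, rfl⟩
    refine ⟨fun v => hp _, fun e => ?_, h0⟩
    by_cases he : e ∈ T
    · have : π (G.src e) = π (G.tgt e) := Quot.sound ⟨e, he, rfl, rfl⟩
      simp [φ, LinearMap.funLeft_apply, this]
    · exact hs ⟨e, he⟩
  · intro hp
    have hlift (u v : V) (h : ∃ e ∈ T, G.src e = u ∧ G.tgt e = v) : p u = p v := by
      obtain ⟨e, he, rfl, rfl⟩ := h
      rw [← sub_eq_zero, sub_eq_of_mem_splineSpace hp, hT p hp e he, C_0, zero_mul]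
    exact ⟨Quot.lift p hlift, ⟨by rintro ⟨v⟩; exact hp.1 v, fun e => hp.2.1 e.1, hp.2.2⟩,
      rfl⟩

end Splines

namespace PlaneEmbedding

variable [DecidableEq F] [Fintype E]

theorem extMatrix_eq_zero {R : Type*} [CommRing R] (P : G.PlaneEmbedding F) {S : Finset F}
    (a : E → R) {f : F} (hf : f ∈ S) (i : Fin 3) {e : E} (he : e ∉ P.boundaryEdges S) :
    P.extMatrix a (f, i) e = 0 := by
  have h (b : Bool) : P.face (e, b) ≠ some f := fun h =>
    he (Finset.mem_filter.2 ⟨Finset.mem_univ _, f, hf, b, h⟩)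
  simp [extMatrix, cycleMatrix, h]

theorem GenericLabels.mulVec_injective [Field K] {P : G.PlaneEmbedding F} {S : Finset F}
    {a : E → K} (hgen : P.GenericLabels S a) (hS : (P.boundaryEdges S).card ≤ 3 * S.card) :
    Function.Injective (P.innerBlock S a).mulVec := by
  obtain ⟨r, c, -, hdet⟩ := hgen
  have hmap : (P.innerBlock S (MvPolynomial.X : E → MvPolynomial E K)).map (MvPolynomial.eval a)
      = P.innerBlock S a := by
    ext i e
    simp [innerBlock, extMatrix]
  rw [RingHom.map_det, RingHom.mapMatrix_apply, ← Matrix.submatrix_map, hmap] at hdet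
  have hc : Function.Bijective c := by
    rw [Fintype.bijective_iff_injective_and_card]
    exact ⟨c.injective, by simp [hS]⟩
  let c' := Equiv.ofBijective c hc
  rw [← Matrix.coe_mulVecLin, ← LinearMap.ker_eq_bot, LinearMap.ker_eq_bot']
  intro v hv
  rw [Matrix.mulVecLin_apply] at hv
  have h : ((P.innerBlock S a).submatrix r c').mulVec (v ∘ c') = 0 := by
    rw [Matrix.submatrix_mulVec_equiv, Function.comp_assoc, Equiv.self_comp_symm,
      Function.comp_id, hv]
    rfl
  have h0 := Matrix.eq_zero_of_mulVec_eq_zero hdet h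
  funext e
  simpa using congrFun h0 (c'.symm e)

theorem submatrix_extMatrix_eq_fromBlocks {R : Type*} [CommRing R] (P : G.PlaneEmbedding F)
    (S : Finset F) (a : E → R) :
    (P.extMatrix a).submatrix
          (Sum.elim (Prod.map Subtype.val id) (Prod.map Subtype.val id) :
            ({f // f ∈ S} × Fin 3) ⊕ ({f // f ∉ S} × Fin 3) → F × Fin 3)
          (Sum.elim Subtype.val Subtype.val :
            {e // e ∈ P.boundaryEdges S} ⊕ {e // e ∉ P.boundaryEdges S} → E) =
        Matrix.fromBlocks (P.innerBlock S a) 0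
          ((P.extMatrix a).submatrix (Prod.map Subtype.val id) Subtype.val)
          (P.outerBlock S a) := by
  ext (i | i) (e | e)
  · rfl
  · exact P.extMatrix_eq_zero a i.1.2 i.2 e.2
  · rfl
  · rfl

theorem rank_extMatrix_eq_add [Field K] [DecidableEq E] (P : G.PlaneEmbedding F) (S : Finset F) (a : E → K)
    (hinj : Function.Injective (P.innerBlock S a).mulVec) :
    (P.extMatrix a).rank = (P.innerBlock S a).rank + (P.outerBlock S a).rank := by
  rw [outerBlock, ← Matrix.rank_fromBlocks_zero₁₂_of_mulVec_injective _ _ _ hinj,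
    ← outerBlock, ← submatrix_extMatrix_eq_fromBlocks]
  let er : ({f // f ∈ S} × Fin 3) ⊕ ({f // f ∉ S} × Fin 3) ≃ F × Fin 3 :=
    (Equiv.sumProdDistrib _ _ _).symm.trans
      (Equiv.prodCongr (Equiv.sumCompl (· ∈ S)) (Equiv.refl _))
  rw [← Matrix.rank_submatrix (P.extMatrix a) er (Equiv.sumCompl (· ∈ P.boundaryEdges S))]
  congr 2
  ext (i | i) <;> rfl

theorem edgeCoeff_eq_zero [Field K] [DecidableEq E] [Finite V] [Fintype F] (P : G.PlaneEmbedding F) {S : Finset F}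
    (h2 : (2 : K) ≠ 0) {a : E → K} {v₀ : V}
    (hinj : Function.Injective (P.innerBlock S a).mulVec) {p : V → MvPolynomial (Fin 2) K}
    (hp : p ∈ G.splineSpace 2 (squareLabel a) v₀) {e : E} (he : e ∈ P.boundaryEdges S) :
    G.edgeCoeff K p e = 0 := by
  have hker : G.edgeCoeff K p ∈ LinearMap.ker (P.extMatrix a).mulVecLin :=
    P.map_edgeCoeff_splineSpace h2 a v₀ ▸ Submodule.mem_map_of_mem hp
  have hzero : (P.innerBlock S a).mulVec (G.edgeCoeff K p ∘ Subtype.val) = 0 := by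
    funext i
    refine Eq.trans ?_ (congrFun hker (i.1.1, i.2))
    simp only [Matrix.mulVecLin_apply, Matrix.mulVec, dotProduct]
    rw [← Equiv.sum_comp (Equiv.sumCompl (· ∈ P.boundaryEdges S)), Fintype.sum_sum_type]
    refine (add_eq_left.2 (Finset.sum_eq_zero fun x _ => ?_)).symm
    rw [Equiv.sumCompl_apply_inr, P.extMatrix_eq_zero a i.1.2 i.2 x.2, zero_mul]
  exact congrFun (hinj (hzero.trans (Matrix.mulVec_zero _).symm)) ⟨e, he⟩

end PlaneEmbedding

end DirectedMultigraph

theorem mainTheorem8 {V E F : Type*} [Fintype V] [Fintype E] [Fintype F]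
    [DecidableEq E] [DecidableEq F]
    (G : DirectedMultigraph V E) (P : G.PlaneEmbedding F) (a : E → ℂ) (v₀ : V)
    (S : Finset F) (hS : (P.boundaryEdges S).card ≤ 3 * S.card) (hgen : P.GenericLabels S a) :
    -- the block-triangular form
    (∃ B : Matrix ({f // f ∉ S} × Fin 3) {e // e ∈ P.boundaryEdges S} ℂ,
      (P.extMatrix a).submatrix
          (Sum.elim (Prod.map Subtype.val id) (Prod.map Subtype.val id) :
            ({f // f ∈ S} × Fin 3) ⊕ ({f // f ∉ S} × Fin 3) → F × Fin 3)
          (Sum.elim Subtype.val Subtype.val :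
            {e // e ∈ P.boundaryEdges S} ⊕ {e // e ∉ P.boundaryEdges S} → E) =
        Matrix.fromBlocks (P.innerBlock S a) 0 B (P.outerBlock S a)) ∧
    (P.extMatrix a).rank = (P.innerBlock S a).rank + (P.outerBlock S a).rank ∧
    -- additivity of the rank, for every plane embedding of the contracted graph
    (∀ (F' : Type*) [Fintype F'] [DecidableEq F']
      (Q : (G.contract (P.boundaryEdges S)).PlaneEmbedding F'),
      (P.extMatrix a).rank =
        (P.innerBlock S a).rank + (Q.extMatrix fun e => a e.1).rank) ∧
    -- contraction does not change the dimension
    Module.finrank ℂ (G.splineSpace 2 (DirectedMultigraph.squareLabel a) v₀) =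
      Module.finrank ℂ ((G.contract (P.boundaryEdges S)).splineSpace 2
        (DirectedMultigraph.squareLabel fun e => a e.1) (Quot.mk _ v₀)) := by
  have h2 : (2 : ℂ) ≠ 0 := two_ne_zero
  have hinj := hgen.mulVec_injective hS
  have hspl := DirectedMultigraph.finrank_splineSpace_contract (P.boundaryEdges S) a v₀
    fun p hp e he => P.edgeCoeff_eq_zero h2 hinj hp he
  refine ⟨⟨_, P.submatrix_extMatrix_eq_fromBlocks S a⟩, P.rank_extMatrix_eq_add S a hinj, ?_,
    hspl.symm⟩
  intro F' _ _ Q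
  have hP := P.rank_extMatrix_add_finrank_splineSpace h2 a v₀
  have hQ := Q.rank_extMatrix_add_finrank_splineSpace h2 (fun e => a e.1) (Quot.mk _ v₀)
  have hA : (P.innerBlock S a).rank = Fintype.card {e // e ∈ P.boundaryEdges S} := by
    rw [Matrix.rank, LinearMap.finrank_range_of_inj (f := (P.innerBlock S a).mulVecLin) hinj,
      Module.finrank_pi]
  have hcard := Fintype.card_congr (Equiv.sumCompl (· ∈ P.boundaryEdges S))
  rw [Fintype.card_sum] at hcard
  omega
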